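/- Let $G$ be a finite abelian group, written additively. Let $\mathcal F(G)$ be the free abelian monoid with basis $G$ (its elements are the finite multisets of elements of $G$), and let $\mathcal B(G)=\{g_1\cdots g_\ell\in\mathcal F(G): g_1+\dots+g_\ell=0\}$ be the monoid of zero-sum sequences over $G$. It is a reduced commutative monoid (its only invertible element is the empty sequence). An atom of $\mathcal B(G)$ is an element $u\neq 1$ such that $u=bc$ with $b,c\in\mathcal B(G)$ implies $b=1$ or $c=1$. For $a\in\mathcal B(G)$, a factorization of $a$ is a finite multiset $z=u_1\cdots u_k$ of atoms with product $a$; its length is $|z|=k$. Let $\mathsf Z(a)$ be the set of factorizations of $a$, $\mathsf L(a)=\{|z|: z\in\mathsf Z(a)\}\subset\mathbb N_0$, and $\mathcal L(G)=\{\mathsf L(a): a\in\mathcal B(G)\}$. Further: - For $k\in\mathbb N=\{1,2,\dots\}$, let $\mathcal U_k(G)$ be the union of all $L\in\mathcal L(G)$ with $k\in L$. - Let $\Delta(G)$ be the set of all $d\in\mathbb N$ for which there are $L\in\mathcal L(G)$ and $m\in L$ with $L\cap[m,m+d]=\{m,m+d\}$. - For factorizations $z,z'$, write $z=wv$ and $z'=wv'$,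 where $w$ is the greatest common divisor of $z$ and $z'$ as multisets of atoms, and let $\mathsf d(z,z')=\max\{|v|,|v'|\}$. Let $\mathsf c(a)$ be the smallest $N\in\mathbb N_0\cup\{\infty\}$ such that for all $z,z'\in\mathsf Z(a)$ there are $z=z_0,z_1,\dots,z_n=z'$ in $\mathsf Z(a)$ with $\mathsf d(z_{i-1},z_i)\le N$ for all $1\le i\le n$. Let $\mathrm{Ca}(G)=\{\mathsf c(a): a\in\mathcal B(G),\ \mathsf c(a)>0\}$. A finite interval is a set $[x,y]=\{n\in\mathbb Z: x\le n\le y\}$ with integers $x,y\ge 0$; it is empty if $y<x$. **Theorem 6.1.** 1. (Carlitz 1960) $|L|=1$ for every $L\in\mathcal L(G)$ if and only if $|G|\le 2$. 2. For every $k\in\mathbb N$, the union $\mathcal U_k(G)$ is a finite interval. 3. The set of distances $\Delta(G)$ and the set of catenary degrees $\mathrm{Ca}(G)$ are finite intervals. -/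

import Mathlib

namespace ZeroSum

section Factorization

/-!  Arithmetic of a reduced commutative monoid `H`, written additively.  As `H` is reduced (its only
invertible element is `0`), the passage to the associated reduced monoid is not needed. -/

variable {H : Type*} [AddCommMonoid H]

/-- The set `Z(a)` of factorizations of `a`: finite multisets of atoms with sum `a`.  An atom is a
non-invertible element `u` such that `u = b + c` implies that `b` or `c` is invertible. -/
def factorizations (a : H) : Set (Multiset H) :=
  {z | (∀ u ∈ z, AddIrreducible u) ∧ z.sum = a}

/-- The set of lengths `L(a)`. -/
def lengths (a : H) : Set ℕ :=
  Multiset.card '' factorizations a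

/-- The system of sets of lengths `{L(a) : a ∈ H}`. -/
def systemOfLengths (H : Type*) [AddCommMonoid H] : Set (Set ℕ) :=
  Set.range (lengths : H → Set ℕ)

/-- The set of distances `Δ(L)` of a set `L` of natural numbers: the differences of any two
consecutive elements of `L`. -/
def distances (L : Set ℕ) : Set ℕ :=
  {d | 0 < d ∧ ∃ a ∈ L, L ∩ Set.Icc a (a + d) = {a, a + d}}

/-- The set of distances `Δ(H)`, the union of all `Δ(L)` over the sets of lengths `L`. -/
def setOfDistances (H : Type*) [AddCommMonoid H] : Set ℕ :=
  ⋃ L ∈ systemOfLengths H, distances L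

/-- The union `U_k(H)` of all sets of lengths that contain `k`. -/
def unionOfLengths (H : Type*) [AddCommMonoid H] (k : ℕ) : Set ℕ :=
  ⋃ L ∈ {L ∈ systemOfLengths H | k ∈ L}, L

open Classical in
/-- The distance of two factorizations: cancel their greatest common part and take the larger of
the two remaining lengths. -/
noncomputable def dist (z z' : Multiset H) : ℕ :=
  max (z - z').card (z' - z).card

/-- `z` and `z'` are joined by a finite chain of factorizations of `a` in which the distance of any
two consecutive terms is at most `N`. -/
def ChainConnected (a : H) (N : ℕ∞) (z z' : Multiset H) : Prop :=
  Relation.ReflTransGen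
    (fun x y => x ∈ factorizations a ∧ y ∈ factorizations a ∧ (dist x y : ℕ∞) ≤ N) z z'

/-- The catenary degree `c(a)`: the smallest `N ∈ ℕ ∪ {∞}` such that any two factorizations of `a`
are joined by an `N`-chain.  The set below contains `∞`, so that the infimum is a minimum. -/
noncomputable def catenaryDegree (a : H) : ℕ∞ :=
  sInf {N : ℕ∞ | ∀ z ∈ factorizations a, ∀ z' ∈ factorizations a, ChainConnected a N z z'}

/-- The set `Ca(H)` of positive catenary degrees. -/
def setOfCatenaryDegrees (H : Type*) [AddCommMonoid H] : Set ℕ∞ :=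
  {c | 0 < c ∧ ∃ a : H, catenaryDegree a = c}

end Factorization

/-- The monoid `B(G)` of zero-sum sequences over `G`.  A sequence over `G` is an element of the free
abelian monoid with basis `G`, that is, a finite multiset of elements of `G`; it is a zero-sum
sequence if its terms have sum `0`.  The operation is the sum of multisets. -/
def zeroSumMonoid (G : Type*) [AddCommGroup G] : AddSubmonoid (Multiset G) where
  carrier := {S | S.sum = 0}
  zero_mem' := by simp
  add_mem' := by
    intro S T hS hT
    change (S + T).sum = 0
    rw [Multiset.sum_add, show S.sum = 0 from hS, show T.sum = 0 from hT, add_zero]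

/-- The monoid of zero-sum sequences is reduced. -/
theorem zeroSumMonoid_reduced (G : Type*) [AddCommGroup G] (S : zeroSumMonoid G)
    (hS : IsAddUnit S) : S = 0 := by
  obtain ⟨⟨a, b, hab, hba⟩, rfl⟩ := hS
  have h : (a : Multiset G) + (b : Multiset G) = 0 := congrArg Subtype.val hab
  exact Subtype.ext (add_eq_zero.1 h).1

/-- A finite discrete interval `[a, b]` of natural numbers; it is empty if `b < a`. -/
def IsFiniteInterval (S : Set ℕ) : Prop :=
  ∃ a b : ℕ, S = Set.Icc a b

end ZeroSum

namespace ZeroSum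

/-! Everything rests on one operation, `Merge`: replace two terms `g`, `h` of a sequence by the
single term `g + h`. It lowers the number of terms by one, sends atoms to atoms, and disturbs at
most two atoms of a factorization. Conversely, splitting `g + h` inside an atom yields one or two
atoms. Lengths and catenary degrees are therefore controlled up to an error of one, and an induction
on the number of terms cannot skip a value.

For unions and distances, the merge is made inside an atom of a factorization of length `k`, so `k`
survives while a larger length, or a gap above `k`, shrinks by at most one per merge
(`mem_unionOfLengths_of_le`, `mem_setOfDistances_of_le`). For catenary degrees, a bound `M ≥ 2` for
all shorter sequences gives the bound `M + 1` for `a` (`isChainConnected_succ`), so no value from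
`3` on is skipped; the value `1` never occurs.

Finiteness comes from the bound `|G|` on the number of terms of an atom (`len_le_card`). It bounds
the unions, and by an exchange argument all catenary degrees by `|G|²`. A chain must jump over each
gap in a set of lengths, so distances obey the same bound. -/

theorem exists_eq_cons_cons {α : Type*} {s : Multiset α} (h : 2 ≤ Multiset.card s) :
    ∃ g k t, s = g ::ₘ k ::ₘ t := by
  obtain ⟨g, hg⟩ := Multiset.card_pos_iff_exists_mem.1 (by omega : 0 < Multiset.card s)
  obtain ⟨t, rfl⟩ := Multiset.exists_cons_of_mem hg
  rw [Multiset.card_cons] at h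
  obtain ⟨k, hk⟩ := Multiset.card_pos_iff_exists_mem.1 (by omega : 0 < Multiset.card t)
  obtain ⟨t, rfl⟩ := Multiset.exists_cons_of_mem hk
  exact ⟨g, k, t, rfl⟩

/-! ### Zero-sum sequences, atoms and factorizations -/

section Basic

variable {G : Type*} [AddCommGroup G]

theorem isAddUnit_iff_eq_zero {a : zeroSumMonoid G} : IsAddUnit a ↔ a = 0 :=
  ⟨zeroSumMonoid_reduced G a, fun h => h ▸ isAddUnit_zero⟩

/-- The number of terms of a zero-sum sequence. -/
def len : zeroSumMonoid G →+ ℕ := Multiset.cardHom.comp (zeroSumMonoid G).subtype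

theorem len_apply (a : zeroSumMonoid G) : len a = Multiset.card (a : Multiset G) := rfl

theorem len_eq_zero {a : zeroSumMonoid G} : len a = 0 ↔ a = 0 := by
  rw [len_apply, Multiset.card_eq_zero, ZeroMemClass.coe_eq_zero]

theorem len_pos {a : zeroSumMonoid G} (h : a ≠ 0) : 0 < len a :=
  Nat.pos_of_ne_zero fun h' => h (len_eq_zero.1 h')

theorem sum_coe (a : zeroSumMonoid G) : (a : Multiset G).sum = 0 := a.2

theorem add_left_cancel_coe {a b c : zeroSumMonoid G} (h : a + b = a + c) : b = c :=
  Subtype.ext (add_left_cancel (congrArg Subtype.val h))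

theorem eq_zero_of_add_eq_zero {a b : zeroSumMonoid G} (h : a + b = 0) : a = 0 ∧ b = 0 := by
  have h' : (a : Multiset G) + b = 0 := congrArg Subtype.val h
  exact ⟨Subtype.ext (add_eq_zero.1 h').1, Subtype.ext (add_eq_zero.1 h').2⟩

theorem exists_eq_add_of_coe_le {a b : zeroSumMonoid G} (h : (a : Multiset G) ≤ b) :
    ∃ c, b = a + c := by
  obtain ⟨s, hs⟩ := Multiset.le_iff_exists_add.1 h
  refine ⟨⟨s, ?_⟩, Subtype.ext hs⟩
  have := congrArg Multiset.sum hs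
  rw [Multiset.sum_add, sum_coe, sum_coe, zero_add] at this
  exact this.symm

theorem addIrreducible_iff {u : zeroSumMonoid G} :
    AddIrreducible u ↔ u ≠ 0 ∧ ∀ b c, u = b + c → b = 0 ∨ c = 0 := by
  constructor
  · intro h
    exact ⟨fun h0 => h.not_isAddUnit (isAddUnit_iff_eq_zero.2 h0), fun b c hbc =>
      (h.isAddUnit_or_isAddUnit hbc).imp isAddUnit_iff_eq_zero.1 isAddUnit_iff_eq_zero.1⟩
  · rintro ⟨h0, h⟩
    exact ⟨fun hu => h0 (isAddUnit_iff_eq_zero.1 hu), fun b c hbc =>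
      (h b c hbc).imp isAddUnit_iff_eq_zero.2 isAddUnit_iff_eq_zero.2⟩

theorem ne_zero_of_addIrreducible {u : zeroSumMonoid G} (hu : AddIrreducible u) : u ≠ 0 :=
  (addIrreducible_iff.1 hu).1

theorem eq_of_coe_le_addIrreducible {u a : zeroSumMonoid G} (hu : AddIrreducible u) (ha : a ≠ 0)
    (h : (a : Multiset G) ≤ u) : a = u := by
  obtain ⟨c, rfl⟩ := exists_eq_add_of_coe_le h
  rcases (addIrreducible_iff.1 hu).2 a c rfl with h | h
  · exact absurd h ha
  · rw [h, add_zero]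

theorem add_mem_factorizations {a b : zeroSumMonoid G} {z w : Multiset (zeroSumMonoid G)}
    (hz : z ∈ factorizations a) (hw : w ∈ factorizations b) : z + w ∈ factorizations (a + b) := by
  refine ⟨fun u hu => ?_, by rw [Multiset.sum_add, hz.2, hw.2]⟩
  rcases Multiset.mem_add.1 hu with h | h
  exacts [hz.1 u h, hw.1 u h]

theorem cons_mem_factorizations {u b : zeroSumMonoid G} {w : Multiset (zeroSumMonoid G)}
    (hu : AddIrreducible u) (hw : w ∈ factorizations b) : u ::ₘ w ∈ factorizations (u + b) := by
  rw [← Multiset.singleton_add]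
  exact add_mem_factorizations ⟨by simpa using hu, by simp⟩ hw

theorem mem_factorizations_sum_of_le {a : zeroSumMonoid G} {z w : Multiset (zeroSumMonoid G)}
    (hz : z ∈ factorizations a) (h : w ≤ z) : w ∈ factorizations w.sum :=
  ⟨fun u hu => hz.1 u (Multiset.mem_of_le h hu), rfl⟩

theorem exists_mem_factorizations (a : zeroSumMonoid G) : ∃ z, z ∈ factorizations a := by
  induction hn : len a using Nat.strong_induction_on generalizing a with
  | _ n ih =>
    by_cases h0 : a = 0
    · exact ⟨0, by simp, by simp [h0]⟩
    by_cases ha : AddIrreducible a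
    · exact ⟨{a}, by simpa using ha, by simp⟩
    rw [addIrreducible_iff] at ha
    push Not at ha
    obtain ⟨b, c, hbc, hb, hc⟩ := ha h0
    have hl : len a = len b + len c := by rw [hbc, map_add]
    have := len_pos hb
    have := len_pos hc
    obtain ⟨z, hz⟩ := ih (len b) (by omega) b rfl
    obtain ⟨w, hw⟩ := ih (len c) (by omega) c rfl
    exact ⟨z + w, hbc ▸ add_mem_factorizations hz hw⟩

theorem eq_zero_of_sum_eq_zero {a : zeroSumMonoid G} {z : Multiset (zeroSumMonoid G)}
    (hz : z ∈ factorizations a) (h : a = 0) : z = 0 := by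
  by_contra hne
  obtain ⟨u, hu⟩ := Multiset.exists_mem_of_ne_zero hne
  obtain ⟨w, rfl⟩ := Multiset.exists_cons_of_mem hu
  have h1 := hz.2
  rw [Multiset.sum_cons, h] at h1
  exact ne_zero_of_addIrreducible (hz.1 u hu) (eq_zero_of_add_eq_zero h1).1

theorem len_sum (z : Multiset (zeroSumMonoid G)) : len z.sum = (z.map len).sum :=
  map_multiset_sum len z

theorem card_le_len {a : zeroSumMonoid G} {z : Multiset (zeroSumMonoid G)}
    (hz : z ∈ factorizations a) : Multiset.card z ≤ len a := by
  rw [← hz.2, len_sum, ← Multiset.card_map len z]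
  refine (Multiset.card_nsmul_le_sum (a := 1) fun x hx => ?_).trans' (by simp)
  obtain ⟨u, hu, rfl⟩ := Multiset.mem_map.1 hx
  exact len_pos (ne_zero_of_addIrreducible (hz.1 u hu))

theorem exists_two_le_len {a : zeroSumMonoid G} {z : Multiset (zeroSumMonoid G)}
    (hz : z ∈ factorizations a) (h : Multiset.card z < len a) : ∃ u ∈ z, 2 ≤ len u := by
  by_contra! hc
  refine absurd h (not_lt.2 ?_)
  rw [← hz.2, len_sum, ← Multiset.card_map len z]
  refine (Multiset.sum_le_card_nsmul _ 1 fun x hx => ?_).trans (by simp)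
  obtain ⟨u, hu, rfl⟩ := Multiset.mem_map.1 hx
  have := hc u hu
  omega

theorem exists_mem_of_mem_sum {z : Multiset (zeroSumMonoid G)} {g : G}
    (h : g ∈ (z.sum : Multiset G)) : ∃ u ∈ z, g ∈ (u : Multiset G) := by
  induction z using Multiset.induction with
  | empty => simp at h
  | cons v z ih =>
    rw [Multiset.sum_cons, AddSubmonoid.coe_add, Multiset.mem_add] at h
    rcases h with h | h
    · exact ⟨v, by simp, h⟩
    · obtain ⟨u, hu, hgu⟩ := ih h
      exact ⟨u, Multiset.mem_cons_of_mem hu, hgu⟩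

/-- An atom over a finite abelian group has at most `|G|` terms. -/
theorem len_le_card [Finite G] {u : zeroSumMonoid G} (hu : AddIrreducible u) :
    len u ≤ Nat.card G := by
  by_contra! hlt
  obtain ⟨l, hl⟩ := Quot.exists_rep (u : Multiset G)
  replace hl : (u : Multiset G) = ↑l := hl.symm
  have hlen : len u = l.length := by rw [len_apply, hl, Multiset.coe_card]
  -- Pigeonhole on the prefix sums. The full prefix is left out, so that the block between two equal
  -- prefix sums is a proper part of `u`.
  have hni : ¬ Function.Injective fun i : Fin l.length => (l.take i).sum := by
    intro hi
    have := Nat.card_le_card_of_injective _ hi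
    rw [Nat.card_fin] at this
    omega
  have : ∃ i j : ℕ, i < j ∧ j < l.length ∧ (l.take i).sum = (l.take j).sum := by
    simp only [Function.Injective] at hni
    push Not at hni
    obtain ⟨i, j, hij, hne⟩ := hni
    rcases lt_or_gt_of_ne hne with h | h
    · exact ⟨i, j, h, j.2, hij⟩
    · exact ⟨j, i, h, i.2, hij.symm⟩
  obtain ⟨i, j, hij, hj, hs⟩ := this
  have hsum : ((l.take j).drop i).sum = 0 := by
    have h1 := List.sum_append (l₁ := (l.take j).take i) (l₂ := (l.take j).drop i)
    rw [List.take_append_drop, List.take_take, min_eq_left hij.le, hs] at h1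
    simpa using h1
  have hlen' : ((l.take j).drop i).length = j - i := by
    rw [List.length_drop, List.length_take, min_eq_left hj.le]
  let a : zeroSumMonoid G := ⟨((l.take j).drop i : List G), by
    change Multiset.sum _ = 0
    rw [Multiset.sum_coe, hsum]⟩
  have ha : len a = j - i := by
    rw [len_apply, ← hlen', ← Multiset.coe_card]
  have h0 : a ≠ 0 := by
    intro h
    rw [h, map_zero] at ha
    omega
  have hle : (a : Multiset G) ≤ u := by
    rw [hl]
    exact Multiset.coe_le.2 ((List.drop_sublist _ _).trans (List.take_sublist _ _)).subperm
  have := congrArg len (eq_of_coe_le_addIrreducible hu h0 hle)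
  omega

theorem len_le_card_mul [Finite G] {a : zeroSumMonoid G} {z : Multiset (zeroSumMonoid G)}
    (hz : z ∈ factorizations a) : len a ≤ Multiset.card z * Nat.card G := by
  rw [← hz.2, len_sum, ← Multiset.card_map len z, ← smul_eq_mul]
  refine Multiset.sum_le_card_nsmul _ _ fun x hx => ?_
  obtain ⟨u, hu, rfl⟩ := Multiset.mem_map.1 hx
  exact len_le_card (hz.1 u hu)

end Basic

/-! ### Merging two terms and splitting a term -/

section Merge

variable {G : Type*} [AddCommGroup G] {g h : G} {a b c : zeroSumMonoid G}

/-- `b` arises from `a` by replacing two terms `g` and `h` by their sum. -/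
def Merge (g h : G) (a b : zeroSumMonoid G) : Prop :=
  ∃ s : Multiset G, (a : Multiset G) = g ::ₘ h ::ₘ s ∧ (b : Multiset G) = (g + h) ::ₘ s

theorem exists_merge {s : Multiset G} (ha : (a : Multiset G) = g ::ₘ h ::ₘ s) :
    ∃ b, Merge g h a b := by
  refine ⟨⟨(g + h) ::ₘ s, ?_⟩, s, ha, rfl⟩
  have := sum_coe a
  rw [ha, Multiset.sum_cons, Multiset.sum_cons, ← add_assoc] at this
  change Multiset.sum _ = 0
  rw [Multiset.sum_cons, this]

theorem exists_merge_of_two_le_len (ha : 2 ≤ len a) : ∃ g h b, Merge g h a b := by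
  obtain ⟨g, h, s, hs⟩ := exists_eq_cons_cons ha
  obtain ⟨b, hb⟩ := exists_merge hs
  exact ⟨g, h, b, hb⟩

theorem exists_merge_of_mem (hb : g + h ∈ (b : Multiset G)) : ∃ a, Merge g h a b := by
  obtain ⟨s, hs⟩ := Multiset.exists_cons_of_mem hb
  refine ⟨⟨g ::ₘ h ::ₘ s, ?_⟩, s, rfl, hs⟩
  have := sum_coe b
  rw [hs, Multiset.sum_cons] at this
  change Multiset.sum _ = 0
  rw [Multiset.sum_cons, Multiset.sum_cons, ← add_assoc, this]

theorem Merge.mem (hm : Merge g h a b) : g + h ∈ (b : Multiset G) := by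
  obtain ⟨s, -, hs⟩ := hm
  simp [hs]

theorem Merge.right_unique (h₁ : Merge g h a b) (h₂ : Merge g h a c) : b = c := by
  obtain ⟨s, hs, hs'⟩ := h₁
  obtain ⟨t, ht, ht'⟩ := h₂
  rw [hs, Multiset.cons_inj_right, Multiset.cons_inj_right] at ht
  exact Subtype.ext (by rw [hs', ht', ht])

theorem Merge.left_unique (h₁ : Merge g h a c) (h₂ : Merge g h b c) : a = b := by
  obtain ⟨s, hs, hs'⟩ := h₁
  obtain ⟨t, ht, ht'⟩ := h₂
  rw [hs', Multiset.cons_inj_right] at ht'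
  exact Subtype.ext (by rw [hs, ht, ht'])

theorem Merge.len_eq (hm : Merge g h a b) : len a = len b + 1 := by
  obtain ⟨s, hs, hs'⟩ := hm
  simp [len_apply, hs, hs']

theorem Merge.ne_zero_right (hm : Merge g h a b) : b ≠ 0 := by
  rintro rfl
  simpa using hm.mem

theorem Merge.ne_zero_left (hm : Merge g h a b) : a ≠ 0 := by
  rintro rfl
  have := hm.len_eq
  simp at this

theorem Merge.add_right (hm : Merge g h a b) (c : zeroSumMonoid G) :
    Merge g h (a + c) (b + c) := by
  obtain ⟨s, hs, hs'⟩ := hm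
  exact ⟨s + c, by simp [hs], by simp [hs']⟩

/-- In a decomposition of `b`, split `g + h` back inside the summand that contains it. This
decomposes `a`, and the split summand is nonzero, so the other one vanishes. -/
theorem Merge.addIrreducible (hm : Merge g h a b) (ha : AddIrreducible a) : AddIrreducible b := by
  have key : ∀ x y, b = x + y → g + h ∈ (x : Multiset G) → y = 0 := by
    rintro x y rfl hx
    obtain ⟨x', hx'⟩ := exists_merge_of_mem hx
    have := hm.left_unique (hx'.add_right y)
    exact ((addIrreducible_iff.1 ha).2 _ _ this).resolve_left hx'.ne_zero_left
  refine addIrreducible_iff.2 ⟨hm.ne_zero_right, fun x y hxy => ?_⟩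
  have hmem := hm.mem
  rw [hxy, AddSubmonoid.coe_add, Multiset.mem_add] at hmem
  rcases hmem with hx | hy
  · exact Or.inr (key x y hxy hx)
  · exact Or.inl (key y x (hxy.trans (add_comm _ _)) hy)

/-- The two terms that are merged lie in at most two of the summands. -/
theorem Merge.exists_eq_add {z : Multiset (zeroSumMonoid G)} (hm : Merge g h z.sum b) :
    ∃ y c m, z = y + c ∧ 1 ≤ Multiset.card y ∧ Multiset.card y ≤ 2 ∧ Merge g h y.sum m ∧
      b = m + c.sum := by
  suffices H : ∃ y c m, z = y + c ∧ 1 ≤ Multiset.card y ∧ Multiset.card y ≤ 2 ∧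
      Merge g h y.sum m by
    obtain ⟨y, c, m, rfl, h1, h2, hy⟩ := H
    refine ⟨y, c, m, rfl, h1, h2, hy, ?_⟩
    rw [Multiset.sum_add] at hm
    exact hm.right_unique (hy.add_right _)
  obtain ⟨s, hs, -⟩ := hm
  obtain ⟨u, hu, hgu⟩ := exists_mem_of_mem_sum (z := z) (g := g) (by simp [hs])
  obtain ⟨z, rfl⟩ := Multiset.exists_cons_of_mem hu
  obtain ⟨t, ht⟩ := Multiset.exists_cons_of_mem hgu
  rw [Multiset.sum_cons, AddSubmonoid.coe_add, ht, Multiset.cons_add,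
    Multiset.cons_inj_right] at hs
  have hmem : h ∈ t + (z.sum : Multiset G) := hs ▸ Multiset.mem_cons_self _ _
  rcases Multiset.mem_add.1 hmem with h' | h'
  · obtain ⟨t, rfl⟩ := Multiset.exists_cons_of_mem h'
    obtain ⟨m, hm⟩ := exists_merge ht
    exact ⟨{u}, z, m, by simp, by simp, by simp, by simpa using hm⟩
  · obtain ⟨v, hv, hhv⟩ := exists_mem_of_mem_sum h'
    obtain ⟨z, rfl⟩ := Multiset.exists_cons_of_mem hv
    obtain ⟨r, hr⟩ := Multiset.exists_cons_of_mem hhv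
    obtain ⟨m, hm⟩ := exists_merge (a := u + v) (g := g) (h := h) (s := t + r) (by
      rw [AddSubmonoid.coe_add, ht, hr, Multiset.cons_add, Multiset.add_cons])
    exact ⟨{u, v}, z, m, by simp, by simp, by simp, by simpa using hm⟩

/-- The merge touches at most two atoms of `z`. Any others would form a complementary summand of the
atom `b`, so there are none. -/
theorem Merge.card_le_two (hm : Merge g h a b) (hb : AddIrreducible b)
    {z : Multiset (zeroSumMonoid G)} (hz : z ∈ factorizations a) :
    1 ≤ Multiset.card z ∧ Multiset.card z ≤ 2 := by
  obtain ⟨hz, rfl⟩ := hz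
  obtain ⟨y, c, m, rfl, h1, h2, hy, rfl⟩ := hm.exists_eq_add
  have hc := ((addIrreducible_iff.1 hb).2 _ _ rfl).resolve_left hy.ne_zero_right
  have : c = 0 := eq_zero_of_sum_eq_zero
    ⟨fun u hu => hz u (Multiset.mem_add.2 (Or.inr hu)), rfl⟩ hc
  subst this
  simpa using ⟨h1, h2⟩

/-- The one or two atoms touched by the merge are replaced by at least one atom and the rest is
kept, so at most one atom is lost. -/
theorem Merge.exists_factorization_card (hm : Merge g h a b) {z : Multiset (zeroSumMonoid G)}
    (hz : z ∈ factorizations a) :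
    ∃ w ∈ factorizations b, Multiset.card z ≤ Multiset.card w + 1 := by
  obtain ⟨hz, rfl⟩ := hz
  obtain ⟨y, c, m, rfl, h1, h2, hy, rfl⟩ := hm.exists_eq_add
  obtain ⟨x, hx⟩ := exists_mem_factorizations m
  refine ⟨x + c, add_mem_factorizations hx
    ⟨fun u hu => hz u (Multiset.mem_add.2 (Or.inr hu)), rfl⟩, ?_⟩
  have hpos : 0 < Multiset.card x := by
    refine Multiset.card_pos.2 ?_
    rintro rfl
    exact hy.ne_zero_right (by simpa using hx.2.symm)
  simp only [Multiset.card_add]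
  omega

/-- Every factorization of `b` has an atom that can be split. -/
theorem Merge.exists_split (hm : Merge g h a b) {w : Multiset (zeroSumMonoid G)}
    (hw : w ∈ factorizations b) : ∃ u c v, w = u ::ₘ c ∧ Merge g h v u ∧ a = v + c.sum := by
  have hmem := hm.mem
  rw [← hw.2] at hmem
  obtain ⟨u, hu, hgu⟩ := exists_mem_of_mem_sum hmem
  obtain ⟨c, rfl⟩ := Multiset.exists_cons_of_mem hu
  obtain ⟨v, hv⟩ := exists_merge_of_mem hgu
  refine ⟨u, c, v, rfl, hv, ?_⟩
  have := hw.2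
  rw [Multiset.sum_cons] at this
  subst this
  exact hm.left_unique (hv.add_right _)

theorem Merge.exists_split_card (hm : Merge g h a b) {w : Multiset (zeroSumMonoid G)}
    (hw : w ∈ factorizations b) : ∃ z ∈ factorizations a,
      Multiset.card z = Multiset.card w ∨ Multiset.card z = Multiset.card w + 1 := by
  obtain ⟨u, c, v, rfl, hv, rfl⟩ := hm.exists_split hw
  obtain ⟨y, hy⟩ := exists_mem_factorizations v
  refine ⟨y + c, add_mem_factorizations hy
    (mem_factorizations_sum_of_le hw (Multiset.le_cons_self _ _)), ?_⟩
  have := hv.card_le_two (hw.1 u (by simp)) hy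
  simp only [Multiset.card_add, Multiset.card_cons]
  omega

/-- A factorization that is shorter than the sequence has an atom in which two terms can be
merged; this preserves the length of the factorization. -/
theorem exists_merge_of_card_lt {z : Multiset (zeroSumMonoid G)} (hz : z ∈ factorizations a)
    (hlt : Multiset.card z < len a) :
    ∃ g h b u c m, z = u ::ₘ c ∧ Merge g h u m ∧ Merge g h a b ∧ m ::ₘ c ∈ factorizations b := by
  obtain ⟨u, hu, hu2⟩ := exists_two_le_len hz hlt
  obtain ⟨g, h, m, hm⟩ := exists_merge_of_two_le_len hu2
  obtain ⟨c, rfl⟩ := Multiset.exists_cons_of_mem hu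
  obtain ⟨hz, rfl⟩ := hz
  refine ⟨g, h, m + c.sum, u, c, m, rfl, hm, ?_, ?_⟩
  · rw [Multiset.sum_cons]
    exact hm.add_right _
  · exact cons_mem_factorizations (hm.addIrreducible (hz u hu))
      ⟨fun v hv => hz v (Multiset.mem_cons_of_mem hv), rfl⟩

end Merge


theorem isFiniteInterval_of_ordConnected {S : Set ℕ} (hb : BddAbove S) (hS : S.OrdConnected) :
    IsFiniteInterval S := by
  rcases S.eq_empty_or_nonempty with rfl | hne
  · exact ⟨1, 0, by simp⟩
  · refine ⟨sInf S, sSup S, Set.Subset.antisymm (fun x hx => ⟨Nat.sInf_le hx, le_csSup hb hx⟩) ?_⟩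
    exact hS.out (Nat.sInf_mem hne) (Nat.sSup_mem hne hb)

/-! ### Sets of lengths: Carlitz' theorem, unions and distances -/

section Lengths

variable {G : Type*} [AddCommGroup G]

theorem mem_unionOfLengths {H : Type*} [AddCommMonoid H] {k l : ℕ} :
    l ∈ unionOfLengths H k ↔ ∃ a : H, k ∈ lengths a ∧ l ∈ lengths a := by
  simp [unionOfLengths, systemOfLengths]

theorem addIrreducible_of_card_le_three {s : Multiset G} (hs : s.sum = 0) (h0 : 0 ∉ s)
    (hne : s ≠ 0) (h3 : Multiset.card s ≤ 3) : AddIrreducible (⟨s, hs⟩ : zeroSumMonoid G) := by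
  have key : ∀ b : zeroSumMonoid G, (b : Multiset G) ≤ s → Multiset.card (b : Multiset G) ≤ 1 →
      b = 0 := by
    intro b hb h1
    by_contra hb0
    have h2 : len b = 1 := le_antisymm h1 (len_pos hb0)
    obtain ⟨x, hx⟩ : ∃ x, (b : Multiset G) = {x} := Multiset.card_eq_one.1 h2
    have hx0 := sum_coe b
    rw [hx, Multiset.sum_singleton] at hx0
    rw [hx, hx0] at hb
    exact h0 (Multiset.singleton_le.1 hb)
  refine addIrreducible_iff.2 ⟨fun h => hne (congrArg Subtype.val h), fun b c hbc => ?_⟩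
  have hv : s = (b : Multiset G) + c := congrArg Subtype.val hbc
  have hcard := congrArg Multiset.card hv
  rw [Multiset.card_add] at hcard
  by_cases hb1 : Multiset.card (b : Multiset G) ≤ 1
  · exact Or.inl (key b (hv ▸ Multiset.le_add_right _ _) hb1)
  · exact Or.inr (key c (hv ▸ Multiset.le_add_left _ _) (by omega))

/-- Regroup the product of `g, h, -(g + h)` and its negative into the three pairs `x, -x` with `x =
g, h, g + h`. -/
theorem exists_two_mem_three_mem_lengths {g h : G} (hg : g ≠ 0) (hh : h ≠ 0) (hgh : g + h ≠ 0) :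
    ∃ a : zeroSumMonoid G, 2 ∈ lengths a ∧ 3 ∈ lengths a := by
  have hn : ∀ x : G, x ≠ 0 → ∃ u : zeroSumMonoid G, AddIrreducible u ∧ u.1 = {x, -x} :=
    fun x hx => ⟨⟨{x, -x}, by change Multiset.sum _ = 0; simp⟩, addIrreducible_of_card_le_three
      (by simp) (by simp [hx, hx.symm]) (by simp) (by simp), rfl⟩
  obtain ⟨u, hu, hu'⟩ := hn g hg
  obtain ⟨v, hv, hv'⟩ := hn h hh
  obtain ⟨w, hw, hw'⟩ := hn (g + h) hgh
  have hn' : ∀ x y : G, x ≠ 0 → y ≠ 0 → x + y ≠ 0 →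
      ∃ u : zeroSumMonoid G, AddIrreducible u ∧ u.1 = {x, y, -(x + y)} :=
    fun x y hx hy hxy => ⟨⟨{x, y, -(x + y)}, by change Multiset.sum _ = 0; simp⟩,
      addIrreducible_of_card_le_three (by simp)
        (by simpa [hx.symm, hy.symm, eq_comm, -neg_add_rev] using hxy) (by simp) (by simp), rfl⟩
  obtain ⟨p, hp, hp'⟩ := hn' g h hg hh hgh
  obtain ⟨q, hq, hq'⟩ := hn' (-g) (-h) (by simpa) (by simpa) (by
    rw [← neg_add]; exact neg_ne_zero.2 hgh)
  refine ⟨p + q, ⟨{p, q}, ⟨by simp [hp, hq], by simp⟩, by simp⟩,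
    ⟨{u, v, w}, ⟨by simp [hu, hv, hw], Subtype.ext ?_⟩, by simp⟩⟩
  have e : -(-g + -h) = g + h := by abel
  simp only [Multiset.insert_eq_cons, Multiset.sum_cons, Multiset.sum_singleton,
    AddSubmonoid.coe_add, hu', hv', hw', hp', hq', e]
  simp only [← Multiset.singleton_add]
  abel

/-- The only possible atoms are `0` and `x x` with `x ≠ 0`. Counting zeros twice gives every atom
weight `2`; as this weight is additive, it determines the length of a factorization. -/
theorem len_add_count_zero [DecidableEq G] [Finite G] (hG : Nat.card G ≤ 2) {u : zeroSumMonoid G}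
    (hu : AddIrreducible u) : len u + (u : Multiset G).count 0 = 2 := by
  have h2 : ∀ x y : G, x ≠ 0 → y ≠ 0 → x = y := by
    intro x y hx hy
    by_contra hxy
    have : Nat.card (Fin 3) ≤ Nat.card G :=
      Nat.card_le_card_of_injective ![0, x, y] (by
        intro i j hij
        fin_cases i <;> fin_cases j <;> simp_all)
    rw [Nat.card_fin] at this
    omega
  have key : ∀ s : Multiset G, s.sum = 0 → s ≠ 0 → s ≤ u → (u : Multiset G) = s := by
    intro s hs hs0 hle
    have := eq_of_coe_le_addIrreducible (a := ⟨s, hs⟩) hu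
      (fun h => hs0 (congrArg Subtype.val h)) hle
    rw [← this]
  rw [len_apply]
  by_cases h0 : (0 : G) ∈ (u : Multiset G)
  · rw [key {0} (by simp) (by simp) (by simpa using h0)]
    simp
  · rw [Multiset.count_eq_zero_of_notMem h0, add_zero]
    have hlen : 2 ≤ len u := by
      have h1 := len_pos (ne_zero_of_addIrreducible hu)
      by_contra h3
      obtain ⟨x, hx⟩ := Multiset.card_eq_one.1 (show Multiset.card (u : Multiset G) = 1 by
        rw [len_apply] at h1 h3; omega)
      have := sum_coe u
      rw [hx, Multiset.sum_singleton] at this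
      simp [hx, this] at h0
    obtain ⟨x, y, s, hs⟩ : ∃ x y s, (u : Multiset G) = x ::ₘ y ::ₘ s := exists_eq_cons_cons hlen
    simp only [hs, Multiset.mem_cons, not_or] at h0
    have hxy : x + y = 0 := by
      by_contra hne
      exact Ne.symm h0.2.1 (left_eq_add.1 (h2 x (x + y) (Ne.symm h0.1) hne))
    rw [key {x, y} (by simpa using hxy) (by simp) (by
      rw [hs, Multiset.insert_eq_cons, ← Multiset.singleton_add, ← Multiset.singleton_add x]
      exact add_le_add_right (Multiset.singleton_le.2 (by simp)) _)]
    simp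

theorem lengths_eq_singleton_of_card_le_two [Finite G] (hG : Nat.card G ≤ 2)
    (a : zeroSumMonoid G) : ∃ n, lengths a = {n} := by
  classical
  have key : ∀ z : Multiset (zeroSumMonoid G), (∀ u ∈ z, AddIrreducible u) →
      len z.sum + (z.sum : Multiset G).count 0 = 2 * Multiset.card z := by
    intro z
    induction z using Multiset.induction with
    | empty => simp
    | cons u z ih =>
      intro hz
      have h1 := ih fun v hv => hz v (Multiset.mem_cons_of_mem hv)
      have h2 := len_add_count_zero hG (hz u (by simp))
      rw [Multiset.sum_cons, map_add, AddSubmonoid.coe_add, Multiset.count_add, Multiset.card_cons]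
      omega
  obtain ⟨z, hz⟩ := exists_mem_factorizations a
  refine ⟨Multiset.card z, Set.eq_singleton_iff_unique_mem.2 ⟨⟨z, hz, rfl⟩, ?_⟩⟩
  rintro _ ⟨w, hw, rfl⟩
  have h1 := key z hz.1
  have h2 := key w hw.1
  rw [hz.2] at h1
  rw [hw.2] at h2
  omega

/-- **Carlitz' theorem** for zero-sum monoids. -/
theorem ncard_lengths_eq_one_iff [Finite G] :
    (∀ L ∈ systemOfLengths (zeroSumMonoid G), L.ncard = 1) ↔ Nat.card G ≤ 2 := by
  constructor
  · intro hL
    by_contra! hlt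
    have : ∃ g : G, g ≠ 0 := by
      have : Nontrivial G := Finite.one_lt_card_iff_nontrivial.1 (by omega)
      exact exists_ne 0
    obtain ⟨g, hg⟩ := this
    have : ∃ h : G, h ∉ ({0, -g} : Set G) := by
      by_contra! hall
      have h1 : (Set.univ : Set G) ⊆ {0, -g} := fun x _ => hall x
      have h2 := Set.ncard_le_ncard h1
      have h3 := Set.ncard_insert_le (0 : G) {-g}
      rw [Set.ncard_univ] at h2
      rw [Set.ncard_singleton] at h3
      omega
    obtain ⟨h, hh⟩ := this
    simp only [Set.mem_insert_iff, Set.mem_singleton_iff, not_or] at hh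
    obtain ⟨a, ha2, ha3⟩ := exists_two_mem_three_mem_lengths hg hh.1 fun h' =>
      hh.2 (eq_neg_of_add_eq_zero_right h')
    obtain ⟨n, hn⟩ := Set.ncard_eq_one.1 (hL (lengths a) ⟨a, rfl⟩)
    rw [hn] at ha2 ha3
    exact absurd (ha2.trans ha3.symm) (by decide)
  · rintro hG _ ⟨a, rfl⟩
    obtain ⟨n, hn⟩ := lengths_eq_singleton_of_card_le_two hG a
    simp [hn]

theorem le_len_of_mem_lengths {a : zeroSumMonoid G} {k : ℕ} (hk : k ∈ lengths a) : k ≤ len a := by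
  obtain ⟨z, hz, rfl⟩ := hk
  exact card_le_len hz

/-- If `k < len a` is a length of `a`, then two terms of `a` can be merged such that `k` remains a
length. -/
theorem exists_merge_of_mem_lengths {a : zeroSumMonoid G} {k : ℕ} (hk : k ∈ lengths a)
    (hlt : k < len a) : ∃ g h b, Merge g h a b ∧ k ∈ lengths b := by
  obtain ⟨z, hz, rfl⟩ := hk
  obtain ⟨g, h, b, u, c, m, rfl, -, hab, hm⟩ := exists_merge_of_card_lt hz hlt
  exact ⟨g, h, b, hab, m ::ₘ c, hm, by simp⟩

theorem Merge.exists_mem_lengths {g h : G} {a b : zeroSumMonoid G} (hm : Merge g h a b) {j : ℕ}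
    (hj : j ∈ lengths a) : ∃ i ∈ lengths b, j ≤ i + 1 := by
  obtain ⟨z, hz, rfl⟩ := hj
  obtain ⟨w, hw, hle⟩ := hm.exists_factorization_card hz
  exact ⟨_, ⟨w, hw, rfl⟩, hle⟩

theorem Merge.mem_lengths_or {g h : G} {a b : zeroSumMonoid G} (hm : Merge g h a b) {j : ℕ}
    (hj : j ∈ lengths b) : j ∈ lengths a ∨ j + 1 ∈ lengths a := by
  obtain ⟨w, hw, rfl⟩ := hj
  obtain ⟨z, hz, h | h⟩ := hm.exists_split_card hw
  · exact Or.inl ⟨z, hz, h⟩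
  · exact Or.inr ⟨z, hz, h⟩

/-- Merge inside an atom of a factorization of length `k`. The length `k` is kept and some length `≥
j - 1 ≥ l` remains; since the sequence gets shorter, the descent must stop with the larger length
equal to `l`. -/
theorem mem_unionOfLengths_of_le {k l j : ℕ} (hkl : k ≤ l) (hlj : l ≤ j)
    (h : j ∈ unionOfLengths (zeroSumMonoid G) k) : l ∈ unionOfLengths (zeroSumMonoid G) k := by
  obtain ⟨a, hk, hj⟩ := mem_unionOfLengths.1 h
  clear h
  induction hn : len a using Nat.strong_induction_on generalizing a j with
  | _ n ih =>
    rcases hlj.eq_or_lt with rfl | hlt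
    · exact mem_unionOfLengths.2 ⟨a, hk, hj⟩
    obtain ⟨g, h, b, hab, hkb⟩ :=
      exists_merge_of_mem_lengths hk ((hkl.trans_lt hlt).trans_le (le_len_of_mem_lengths hj))
    obtain ⟨i, hi, hji⟩ := hab.exists_mem_lengths hj
    exact ih (len b) (by have := hab.len_eq; omega) (by omega) b hkb hi rfl

theorem addIrreducible_singleton_zero : AddIrreducible (⟨{0}, by
    change Multiset.sum _ = 0; simp⟩ : zeroSumMonoid G) := by
  refine addIrreducible_iff.2 ⟨fun h => by simpa using congrArg Subtype.val h, fun b c hbc => ?_⟩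
  have h : 1 = len b + len c := by
    rw [← map_add, ← hbc]; rfl
  rcases (by omega : len b = 0 ∨ len c = 0) with h | h
  · exact Or.inl (len_eq_zero.1 h)
  · exact Or.inr (len_eq_zero.1 h)

theorem exists_mem_lengths_zeroSumMonoid (n : ℕ) : ∃ b : zeroSumMonoid G, n ∈ lengths b :=
  ⟨_, Multiset.replicate n _, ⟨fun u hu => by
    rw [Multiset.eq_of_mem_replicate hu]; exact addIrreducible_singleton_zero, rfl⟩, by simp⟩

theorem add_mem_lengths_add {a b : zeroSumMonoid G} {m n : ℕ} (hm : m ∈ lengths a)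
    (hn : n ∈ lengths b) : m + n ∈ lengths (a + b) := by
  obtain ⟨z, hz, rfl⟩ := hm
  obtain ⟨w, hw, rfl⟩ := hn
  exact ⟨z + w, add_mem_factorizations hz hw, by simp⟩

theorem isFiniteInterval_unionOfLengths [Finite G] (k : ℕ) :
    IsFiniteInterval (unionOfLengths (zeroSumMonoid G) k) := by
  refine isFiniteInterval_of_ordConnected ⟨k * Nat.card G, fun j hj => ?_⟩
    ⟨fun x hx y hy l hl => ?_⟩
  · obtain ⟨a, ⟨z, hz, rfl⟩, hja⟩ := mem_unionOfLengths.1 hj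
    exact (le_len_of_mem_lengths hja).trans (len_le_card_mul hz)
  · rcases le_total k l with hkl | hlk
    · exact mem_unionOfLengths_of_le hkl hl.2 hy
    · obtain ⟨a, hk, hxa⟩ := mem_unionOfLengths.1 hx
      -- Below `k` the roles of `k` and `l` are exchanged: multiplying by a sequence with length `l
      -- - x` turns the lengths `k`, `x` into `k + (l - x)`, `l`, and `k` lies between `l` and `k +
      -- (l - x)`.
      obtain ⟨b, hb⟩ := exists_mem_lengths_zeroSumMonoid (G := G) (l - x)
      have h : k + (l - x) ∈ unionOfLengths (zeroSumMonoid G) l := by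
        refine mem_unionOfLengths.2 ⟨a + b, ?_, add_mem_lengths_add hk hb⟩
        have := add_mem_lengths_add hxa hb
        rwa [Nat.add_sub_cancel' hl.1] at this
      obtain ⟨c, h1, h2⟩ := mem_unionOfLengths.1 (mem_unionOfLengths_of_le hlk (by omega) h)
      exact mem_unionOfLengths.2 ⟨c, h2, h1⟩

theorem mem_setOfDistances {H : Type*} [AddCommMonoid H] {d : ℕ} :
    d ∈ setOfDistances H ↔ 0 < d ∧ ∃ (a : H) (k : ℕ), k ∈ lengths a ∧ k + d ∈ lengths a ∧
      ∀ j ∈ lengths a, k < j → k + d ≤ j := by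
  simp only [setOfDistances, systemOfLengths, distances, Set.mem_iUnion, Set.mem_range,
    exists_prop, Set.mem_ofPred_eq]
  constructor
  · rintro ⟨_, ⟨a, rfl⟩, hd, k, hk, h⟩
    have hkd : k + d ∈ lengths a ∩ Set.Icc k (k + d) := h ▸ Or.inr rfl
    refine ⟨hd, a, k, hk, hkd.1, fun j hj hkj => ?_⟩
    by_contra! hlt
    have : j ∈ ({k, k + d} : Set ℕ) := h ▸ ⟨hj, hkj.le, hlt.le⟩
    simp only [Set.mem_insert_iff, Set.mem_singleton_iff] at this
    omega
  · rintro ⟨hd, a, k, hk, hkd, h⟩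
    refine ⟨_, ⟨a, rfl⟩, hd, k, hk, Set.Subset.antisymm ?_ ?_⟩
    · rintro j ⟨hj, hkj, hjd⟩
      rcases hkj.eq_or_lt with rfl | hlt
      · exact Or.inl rfl
      · exact Or.inr (le_antisymm hjd (h j hj hlt))
    · rintro j (rfl | rfl)
      · exact ⟨hk, le_rfl, by omega⟩
      · exact ⟨hkd, by omega, le_rfl⟩

theorem mem_setOfDistances_of_le {d e : ℕ} (he : 0 < e) (hed : e ≤ d)
    (hd : d ∈ setOfDistances (zeroSumMonoid G)) : e ∈ setOfDistances (zeroSumMonoid G) := by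
  classical
  obtain ⟨-, a, k, hk, hkd, hgap⟩ := mem_setOfDistances.1 hd
  clear hd
  induction hn : len a using Nat.strong_induction_on generalizing a d with
  | _ n ih =>
    rcases hed.eq_or_lt with rfl | hlt
    · exact mem_setOfDistances.2 ⟨he, a, k, hk, hkd, hgap⟩
    obtain ⟨g, h, b, hab, hkb⟩ :=
      exists_merge_of_mem_lengths hk
        (lt_of_lt_of_le (by omega) (le_len_of_mem_lengths hkd))
    obtain ⟨i, hi, hdi⟩ := hab.exists_mem_lengths hkd
    have hex : ∃ t, t ∈ lengths b ∧ k < t := ⟨i, hi, by omega⟩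
    obtain ⟨ht, hkt⟩ := Nat.find_spec hex
    have hmin := fun {m} => Nat.find_min' (m := m) hex
    set t := Nat.find hex
    -- Splitting back turns `t` into a length `t` or `t + 1` of `a`, which must clear the gap above
    -- `k`. The new distance `t - k` is thus at least `d - 1 ≥ e`; it may exceed `d`, which is
    -- harmless since the induction is on `len a`.
    have hte : k + d ≤ t + 1 := by
      rcases hab.mem_lengths_or ht with h' | h'
      · have := hgap _ h' hkt
        omega
      · exact hgap _ h' (by omega)
    exact ih (len b) (by have := hab.len_eq; omega) (d := t - k) (by omega) b hkb
      (by rwa [Nat.add_sub_cancel' hkt.le])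
      (fun j hj hkj => by
        have := hmin ⟨hj, hkj⟩
        omega) rfl

end Lengths

/-! ### The distance of factorizations -/

section Distance

variable {H : Type*} {N : ℕ} {z z' : Multiset H}

theorem dist_comm (z z' : Multiset H) : dist z z' = dist z' z := max_comm _ _

theorem dist_add_right (z z' c : Multiset H) : dist (z + c) (z' + c) = dist z z' := by
  classical
  unfold dist
  rw [← add_tsub_add_eq_tsub_right z c z', ← add_tsub_add_eq_tsub_right z' c z]

theorem dist_le_max (z z' : Multiset H) : dist z z' ≤ max (Multiset.card z) (Multiset.card z') := by
  classical
  unfold dist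
  exact max_le_max (Multiset.card_le_card (Multiset.sub_le_self _ _))
    (Multiset.card_le_card (Multiset.sub_le_self _ _))

theorem exists_eq_add_of_dist_le (h : dist z z' ≤ N) :
    ∃ x x' c, z = x + c ∧ z' = x' + c ∧ Multiset.card x ≤ N ∧ Multiset.card x' ≤ N := by
  classical
  unfold dist at h
  obtain ⟨h1, h2⟩ := max_le_iff.1 h
  refine ⟨z - z', z' - z, z ∩ z', ?_, ?_, ?_, ?_⟩
  · exact (Multiset.sub_add_inter z z').symm
  · rw [Multiset.inter_comm]
    exact (Multiset.sub_add_inter z' z).symm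
  · convert h1
  · convert h2

theorem card_le_card_add_dist (z z' : Multiset H) :
    Multiset.card z ≤ Multiset.card z' + dist z z' := by
  obtain ⟨x, x', c, rfl, rfl, h, -⟩ := exists_eq_add_of_dist_le (le_refl (dist z z'))
  rw [Multiset.card_add, Multiset.card_add]
  omega

end Distance

/-! ### Chains of factorizations -/

section Chains

variable {H : Type*} [AddCommMonoid H] {a : H} {N : ℕ} {z z' : Multiset H}

theorem ChainConnected.single (hz : z ∈ factorizations a) (hz' : z' ∈ factorizations a)
    (h : dist z z' ≤ N) : ChainConnected a N z z' :=
  Relation.ReflTransGen.single ⟨hz, hz', by exact_mod_cast h⟩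

theorem ChainConnected.trans {N : ℕ∞} {w : Multiset H} (h : ChainConnected a N z z')
    (h' : ChainConnected a N z' w) : ChainConnected a N z w :=
  Relation.ReflTransGen.trans h h'

theorem ChainConnected.symm {N : ℕ∞} (h : ChainConnected a N z z') : ChainConnected a N z' z := by
  have : Std.Symm fun x y => x ∈ factorizations a ∧ y ∈ factorizations a ∧
      (dist x y : ℕ∞) ≤ N := ⟨fun x y hxy => ⟨hxy.2.1, hxy.1, dist_comm x y ▸ hxy.2.2⟩⟩
  exact Relation.ReflTransGen.stdSymm.symm _ _ h

theorem ChainConnected.mono {N N' : ℕ∞} (hN : N ≤ N') (h : ChainConnected a N z z') :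
    ChainConnected a N' z z' :=
  Relation.ReflTransGen.mono (fun _ _ hxy => ⟨hxy.1, hxy.2.1, hxy.2.2.trans hN⟩) _ _ h

/-- Any two factorizations of `a` are joined by an `N`-chain. -/
def IsChainConnected (a : H) (N : ℕ∞) : Prop :=
  ∀ z ∈ factorizations a, ∀ z' ∈ factorizations a, ChainConnected a N z z'

theorem catenaryDegree_le_iff {N : ℕ∞} : catenaryDegree a ≤ N ↔ IsChainConnected a N := by
  constructor
  · intro h
    have hmem : catenaryDegree a ∈ {N : ℕ∞ | ∀ z ∈ factorizations a, ∀ z' ∈ factorizations a,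
        ChainConnected a N z z'} := by
      refine csInf_mem ⟨⊤, fun z hz z' hz' => ?_⟩
      exact Relation.ReflTransGen.single ⟨hz, hz', le_top⟩
    exact fun z hz z' hz' => (hmem z hz z' hz').mono h
  · exact fun h => sInf_le h

/-- A chain from `z` to `z'` jumps over every gap of `lengths a` between the two lengths. -/
theorem ChainConnected.gap_le {k d : ℕ} (h : ChainConnected a N z z')
    (hgap : ∀ j ∈ lengths a, k < j → k + d ≤ j) (hz : Multiset.card z ≤ k)
    (hz' : k < Multiset.card z') : d ≤ N := by
  induction h with
  | refl => omega
  | @tail x y _ hxy ih =>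
    by_cases hx : k < Multiset.card x
    · exact ih hx
    · have h1 := hgap _ ⟨y, hxy.2.1, rfl⟩ hz'
      have h2 := card_le_card_add_dist y x
      have h3 : dist x y ≤ N := by exact_mod_cast hxy.2.2
      rw [dist_comm] at h2
      omega

end Chains

/-! ### Catenary degrees -/

section Catenary

variable {G : Type*} [AddCommGroup G] {a b : zeroSumMonoid G}

theorem ChainConnected.add_right {N : ℕ∞} {z z' c : Multiset (zeroSumMonoid G)}
    (h : ChainConnected a N z z') (hc : c ∈ factorizations b) :
    ChainConnected (a + b) N (z + c) (z' + c) := by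
  refine Relation.ReflTransGen.lift (· + c) (fun x y hxy => ?_) _ _ h
  exact ⟨add_mem_factorizations hxy.1 hc, add_mem_factorizations hxy.2.1 hc, by
    rw [dist_add_right]; exact hxy.2.2⟩

/-- A sequence `s` below `z.sum` is covered by at most `|s|` of the summands. -/
theorem exists_le_sum_of_le_sum (z : Multiset (zeroSumMonoid G)) (s : Multiset G)
    (h : s ≤ z.sum) : ∃ y ≤ z, Multiset.card y ≤ Multiset.card s ∧ s ≤ y.sum := by
  classical
  induction z using Multiset.induction generalizing s with
  | empty => exact ⟨0, le_rfl, by simp, h⟩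
  | cons u z ih =>
    rw [Multiset.sum_cons, AddSubmonoid.coe_add] at h
    obtain ⟨y, hy, hcard, hle⟩ := ih (s - u) (tsub_le_iff_left.2 h)
    -- Either `u` contributes nothing to `s` and is not needed, or it removes at least one term of
    -- `s`, which pays for including it.
    rcases (Multiset.card_le_card (Multiset.sub_le_self s u)).eq_or_lt with he | hlt
    · rw [Multiset.eq_of_le_of_card_le (Multiset.sub_le_self s u) he.ge] at hcard hle
      exact ⟨y, hy.trans (Multiset.le_cons_self _ _), hcard, hle⟩
    · refine ⟨u ::ₘ y, Multiset.cons_le_cons _ hy, ?_, ?_⟩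
      · rw [Multiset.card_cons]
        omega
      · rw [Multiset.sum_cons, AddSubmonoid.coe_add]
        exact tsub_le_iff_left.1 hle

/-- Exchange argument: an atom `v` of `z'` is covered by at most `|G|` atoms of `z`. Refactoring
their sum so that `v` appears is one step, involving at most `|G|²` atoms on either side; then `v`
is cancelled and the induction applies. -/
theorem isChainConnected_card_mul_card [Finite G] (a : zeroSumMonoid G) :
    IsChainConnected a ((Nat.card G * Nat.card G : ℕ) : ℕ∞) := by
  induction hn : len a using Nat.strong_induction_on generalizing a with
  | _ n ih =>
    intro z hz z' hz'
    rcases Multiset.empty_or_exists_mem z' with rfl | ⟨v, hv⟩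
    · rw [eq_zero_of_sum_eq_zero hz (by simpa using hz'.2.symm)]
      exact Relation.ReflTransGen.refl
    obtain ⟨t, rfl⟩ := Multiset.exists_cons_of_mem hv
    have hvi := hz'.1 v hv
    have ha : a = v + t.sum := by simpa using hz'.2.symm
    have ht := mem_factorizations_sum_of_le hz' (Multiset.le_cons_self t v)
    obtain ⟨y, hyz, hycard, hvy⟩ := exists_le_sum_of_le_sum z v (by
      rw [hz.2, ha, AddSubmonoid.coe_add]; exact Multiset.le_add_right _ _)
    obtain ⟨c, rfl⟩ := Multiset.le_iff_exists_add.1 hyz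
    obtain ⟨r, hr⟩ := exists_eq_add_of_coe_le hvy
    obtain ⟨x, hx⟩ := exists_mem_factorizations r
    have hy := mem_factorizations_sum_of_le hz hyz
    have hc := mem_factorizations_sum_of_le hz (Multiset.le_add_left c y)
    have hvx : v ::ₘ x ∈ factorizations y.sum := hr ▸ cons_mem_factorizations hvi hx
    have ha' : a = y.sum + c.sum := by simpa using hz.2.symm
    have hvl := len_le_card hvi
    have hpos := len_pos (ne_zero_of_addIrreducible hvi)
    have hyc : Multiset.card y ≤ Nat.card G := hycard.trans hvl
    have h1 : ChainConnected a ((Nat.card G * Nat.card G : ℕ) : ℕ∞) (y + c) (v ::ₘ x + c) := by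
      rw [ha']
      refine (ChainConnected.single hy hvx ((dist_le_max _ _).trans (max_le ?_ ?_))).add_right hc
      · exact hyc.trans (Nat.le_mul_of_pos_left _ (by omega))
      · exact (card_le_len hvx).trans
          ((len_le_card_mul hy).trans (Nat.mul_le_mul_right _ hyc))
    have hrc : r + c.sum = t.sum := add_left_cancel_coe (a := v) (by
      rw [← ha, ha', hr, add_assoc])
    have h2 := ih (len t.sum) (by rw [← hn, ha, map_add]; omega) t.sum rfl (x + c)
      (hrc ▸ add_mem_factorizations hx hc) t ht
    have h3 := h2.add_right (b := v) (c := {v}) ⟨by simpa using hvi, by simp⟩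
    rw [add_comm t.sum v, ← ha, add_comm t, Multiset.singleton_add, add_comm (x + c),
      ← add_assoc, Multiset.singleton_add] at h3
    exact h1.trans h3

/-- `z` arises from `w` by splitting a term `g + h` of one of the atoms. -/
def IsSplitting (g h : G) (z w : Multiset (zeroSumMonoid G)) : Prop :=
  ∃ y c u, w = u ::ₘ c ∧ z = y + c ∧ (∀ v ∈ y, AddIrreducible v) ∧ Merge g h y.sum u

variable {g h : G}

theorem exists_isSplitting_add {u : zeroSumMonoid G} (hu : g + h ∈ (u : Multiset G)) :
    ∃ y, ∀ c, IsSplitting g h (y + c) (u ::ₘ c) := by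
  obtain ⟨v, hv⟩ := exists_merge_of_mem hu
  obtain ⟨y, hy, rfl⟩ := exists_mem_factorizations v
  exact ⟨y, fun c => ⟨y, c, u, rfl, rfl, hy, hv⟩⟩

theorem IsSplitting.mem_factorizations {z w : Multiset (zeroSumMonoid G)} (hm : Merge g h a b)
    (hw : w ∈ factorizations b) (hs : IsSplitting g h z w) : z ∈ factorizations a := by
  obtain ⟨y, c, u, rfl, rfl, hy, hu⟩ := hs
  obtain ⟨hw, rfl⟩ := hw
  rw [Multiset.sum_cons] at hm
  rw [hm.left_unique (hu.add_right c.sum)]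
  exact add_mem_factorizations ⟨hy, rfl⟩
    ⟨fun v hv => hw v (Multiset.mem_cons_of_mem hv), rfl⟩

theorem IsSplitting.card_le {z w : Multiset (zeroSumMonoid G)} (hw : w ∈ factorizations b)
    (hs : IsSplitting g h z w) : Multiset.card z ≤ Multiset.card w + 1 := by
  obtain ⟨y, c, u, rfl, rfl, hy, hu⟩ := hs
  have := hu.card_le_two (hw.1 u (by simp)) ⟨hy, rfl⟩
  rw [Multiset.card_add, Multiset.card_cons]
  omega

/-- If the same atom of `w` is split, at most two atoms differ on each side. If different atoms are
split, each side has in addition the atom that only the other one splits. -/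
theorem IsSplitting.dist_le_three {z z' w : Multiset (zeroSumMonoid G)}
    (hw : w ∈ factorizations b) (hs : IsSplitting g h z w) (hs' : IsSplitting g h z' w) :
    dist z z' ≤ 3 := by
  obtain ⟨y, c, u, rfl, rfl, hy, hu⟩ := hs
  obtain ⟨y', c', u', he, rfl, hy', hu'⟩ := hs'
  have h1 := hu.card_le_two (hw.1 u (by simp)) ⟨hy, rfl⟩
  have h2 := hu'.card_le_two (hw.1 u' (by simp [he])) ⟨hy', rfl⟩
  rcases Multiset.cons_eq_cons.1 he with ⟨rfl, rfl⟩ | ⟨-, d, rfl, rfl⟩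
  · rw [dist_add_right]
    exact (dist_le_max _ _).trans (by omega)
  · have e1 : y + u' ::ₘ d = u' ::ₘ y + d := by simp
    have e2 : y' + u ::ₘ d = u ::ₘ y' + d := by simp
    rw [e1, e2, dist_add_right]
    refine (dist_le_max _ _).trans ?_
    rw [Multiset.card_cons, Multiset.card_cons]
    omega

/-- Two factorizations of `b` have splittings whose distance is larger by at most `1`. -/
theorem exists_isSplitting_dist_le {w w' : Multiset (zeroSumMonoid G)} {M : ℕ}
    (hm : Merge g h a b) (hw : w ∈ factorizations b) (hw' : w' ∈ factorizations b)
    (hd : dist w w' ≤ M) :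
    ∃ z z', IsSplitting g h z w ∧ IsSplitting g h z' w' ∧ dist z z' ≤ M + 1 := by
  obtain ⟨x, x', c, rfl, rfl, hx, hx'⟩ := exists_eq_add_of_dist_le hd
  have hmem := hm.mem
  -- If `g + h` occurs in the common part, the same atom is split in both and the bound does not
  -- grow. Otherwise the splitting takes place in the differing parts, each growing by at most one
  -- atom.
  by_cases hc : g + h ∈ (c.sum : Multiset G)
  · obtain ⟨u, hu, hgu⟩ := exists_mem_of_mem_sum hc
    obtain ⟨c, rfl⟩ := Multiset.exists_cons_of_mem hu
    obtain ⟨y, hy⟩ := exists_isSplitting_add hgu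
    refine ⟨y + (x + c), y + (x' + c), by simpa using hy (x + c), by simpa using hy (x' + c), ?_⟩
    rw [add_left_comm, add_left_comm y, dist_add_right]
    exact (dist_le_max _ _).trans (by omega)
  · have key : ∀ x : Multiset (zeroSumMonoid G), Multiset.card x ≤ M → x + c ∈ factorizations b →
        ∃ y, Multiset.card y ≤ M + 1 ∧ IsSplitting g h (y + c) (x + c) := by
      intro x hx hxc
      have hgx : g + h ∈ (x.sum : Multiset G) := by
        rw [← hxc.2, Multiset.sum_add, AddSubmonoid.coe_add, Multiset.mem_add] at hmem
        exact hmem.resolve_right hc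
      obtain ⟨u, hu, hgu⟩ := exists_mem_of_mem_sum hgx
      obtain ⟨x, rfl⟩ := Multiset.exists_cons_of_mem hu
      obtain ⟨y, hy⟩ := exists_isSplitting_add hgu
      refine ⟨y + x, ?_, by simpa [add_assoc] using hy (x + c)⟩
      have h1 := (hy x).card_le
        (mem_factorizations_sum_of_le hxc (Multiset.le_add_right (u ::ₘ x) c))
      omega
    obtain ⟨y, hy, hs⟩ := key x hx hw
    obtain ⟨y', hy', hs'⟩ := key x' hx' hw'
    refine ⟨y + c, y' + c, hs, hs', ?_⟩
    rw [dist_add_right]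
    exact (dist_le_max _ _).trans (max_le hy hy')

/-- An `M`-chain in `b` lifts to `a`: each step lifts with bound `M + 1`, and the lifts of adjacent
steps meet in two splittings of one factorization, at distance at most `3`. This is where `2 ≤ M`
enters. -/
theorem chainConnected_of_isSplitting {M : ℕ} (hM : 2 ≤ M) (hm : Merge g h a b)
    (hb : IsChainConnected b M) {w w' z z' : Multiset (zeroSumMonoid G)}
    (hw : w ∈ factorizations b) (hw' : w' ∈ factorizations b) (hs : IsSplitting g h z w)
    (hs' : IsSplitting g h z' w') : ChainConnected a ((M + 1 : ℕ) : ℕ∞) z z' := by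
  have key : ∀ {w z z'}, w ∈ factorizations b → IsSplitting g h z w → IsSplitting g h z' w →
      ChainConnected a ((M + 1 : ℕ) : ℕ∞) z z' := fun hw hs hs' =>
    ChainConnected.single (hs.mem_factorizations hm hw) (hs'.mem_factorizations hm hw)
      ((hs.dist_le_three hw hs').trans (by omega))
  have hww := hb w hw w' hw'
  clear hw'
  induction hww generalizing z' with
  | refl => exact key hw hs hs'
  | @tail w₁ w₂ _ hstep ih =>
    obtain ⟨h1, h2, hd⟩ := hstep
    obtain ⟨z₁, z₂, hz₁, hz₂, hd'⟩ :=
      exists_isSplitting_dist_le hm h1 h2 (M := M) (by exact_mod_cast hd)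
    exact ((ih hz₁).trans (ChainConnected.single (hz₁.mem_factorizations hm h1)
      (hz₂.mem_factorizations hm h2) hd')).trans (key h2 hz₂ hs')

/-- Only the at most two atoms `y` meeting the merged terms need to change. Since `z` has a third
atom, `y.sum` is shorter than `a`, so the assumed bound `M` connects `y` to a factorization that
arises by splitting. -/
theorem exists_chainConnected_isSplitting {M : ℕ}
    (hlt : ∀ b : zeroSumMonoid G, len b < len a → IsChainConnected b M) (hm : Merge g h a b)
    {z : Multiset (zeroSumMonoid G)} (hz : z ∈ factorizations a) (h3 : 3 ≤ Multiset.card z) :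
    ∃ z₁, ∃ w ∈ factorizations b, IsSplitting g h z₁ w ∧
      ChainConnected a ((M + 1 : ℕ) : ℕ∞) z z₁ := by
  obtain ⟨hz, rfl⟩ := hz
  obtain ⟨y, c, m, rfl, -, hy2, hym, rfl⟩ := hm.exists_eq_add
  have hy : y ∈ factorizations y.sum := ⟨fun v hv => hz v (Multiset.mem_add.2 (Or.inl hv)), rfl⟩
  have hc : c ∈ factorizations c.sum := ⟨fun v hv => hz v (Multiset.mem_add.2 (Or.inr hv)), rfl⟩
  have hc0 : c.sum ≠ 0 := by
    intro h0
    rw [eq_zero_of_sum_eq_zero hc h0, add_zero] at h3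
    omega
  have hconn := hlt y.sum (by
    have := len_pos hc0
    rw [Multiset.sum_add, map_add]
    omega)
  obtain ⟨x, hx⟩ := exists_mem_factorizations m
  obtain ⟨u, x', v, rfl, hvu, hyv⟩ := hym.exists_split hx
  obtain ⟨y', hy'⟩ := exists_mem_factorizations v
  have hx' := mem_factorizations_sum_of_le hx (Multiset.le_cons_self x' u)
  refine ⟨y' + (x' + c), u ::ₘ x' + c, add_mem_factorizations hx hc,
    ⟨y', x' + c, u, by simp, rfl, hy'.1, hy'.2 ▸ hvu⟩, ?_⟩
  have h1 := (hconn y hy (y' + x') (hyv ▸ add_mem_factorizations hy' hx')).add_right hc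
  rw [Multiset.sum_add, ← add_assoc]
  exact h1.mono (by exact_mod_cast Nat.le_succ M)

/-- Two factorizations with at most `M + 1` atoms each are already close enough. Otherwise both are
moved to splittings of factorizations of a common shorter `b`, where the bound `M` is available. -/
theorem isChainConnected_succ {M : ℕ} (hM : 2 ≤ M)
    (hlt : ∀ b : zeroSumMonoid G, len b < len a → IsChainConnected b M) :
    IsChainConnected a ((M + 1 : ℕ) : ℕ∞) := by
  have key : ∀ z ∈ factorizations a, ∀ z' ∈ factorizations a, M + 1 < Multiset.card z' →
      ChainConnected a ((M + 1 : ℕ) : ℕ∞) z z' := by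
    intro z hz z' hz' hcard
    have hlen := card_le_len hz'
    have : ∃ g h b, Merge g h a b ∧ ∃ z₁, ∃ w ∈ factorizations b, IsSplitting g h z₁ w ∧
        ChainConnected a ((M + 1 : ℕ) : ℕ∞) z z₁ := by
      by_cases h3 : 3 ≤ Multiset.card z
      · obtain ⟨g, h, b, hm⟩ := exists_merge_of_two_le_len (a := a) (by omega)
        exact ⟨g, h, b, hm, exists_chainConnected_isSplitting hlt hm hz h3⟩
      -- With at most two atoms in `z`, those meeting the merged terms might make up all of `a`. The
      -- merge is therefore chosen inside one atom of `z`, so that `z` itself is a splitting.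
      · obtain ⟨g, h, b, u, c, m, rfl, hum, hab, hmc⟩ := exists_merge_of_card_lt hz (by omega)
        exact ⟨g, h, b, hab, _, m ::ₘ c, hmc, ⟨{u}, c, m, rfl, (Multiset.singleton_add u c).symm,
          by simpa using hz.1 u (by simp), by simpa using hum⟩, Relation.ReflTransGen.refl⟩
    obtain ⟨g, h, b, hm, z₁, w, hw, hs, hzz₁⟩ := this
    obtain ⟨z₂, w', hw', hs', hzz₂⟩ :=
      exists_chainConnected_isSplitting hlt hm hz' (by omega)
    exact (hzz₁.trans (chainConnected_of_isSplitting hM hm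
      (hlt b (by have := hm.len_eq; omega)) hw hw' hs hs')).trans hzz₂.symm
  intro z hz z' hz'
  by_cases h1 : M + 1 < Multiset.card z'
  · exact key z hz z' hz' h1
  by_cases h2 : M + 1 < Multiset.card z
  · exact (key z' hz' z hz h2).symm
  · exact ChainConnected.single hz hz' ((dist_le_max _ _).trans (by omega))

/-- After cancelling a common part, at most one atom is left on each side, and the two sides have
the same sum. -/
theorem eq_of_dist_le_one {z z' : Multiset (zeroSumMonoid G)} (hz : z ∈ factorizations a)
    (hz' : z' ∈ factorizations a) (hd : dist z z' ≤ 1) : z = z' := by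
  obtain ⟨x, x', c, rfl, rfl, hx, hx'⟩ := exists_eq_add_of_dist_le hd
  have hs : x.sum = x'.sum := by
    have := hz.2.trans hz'.2.symm
    rw [Multiset.sum_add, Multiset.sum_add, add_comm, add_comm x'.sum] at this
    exact add_left_cancel_coe this
  have hxf := mem_factorizations_sum_of_le hz (Multiset.le_add_right x c)
  have hxf' := mem_factorizations_sum_of_le hz' (Multiset.le_add_right x' c)
  congr 1
  rcases Nat.le_one_iff_eq_zero_or_eq_one.1 hx with h | h
  · obtain rfl := Multiset.card_eq_zero.1 h
    exact (eq_zero_of_sum_eq_zero hxf' (by simpa using hs.symm)).symm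
  · rcases Nat.le_one_iff_eq_zero_or_eq_one.1 hx' with h' | h'
    · obtain rfl := Multiset.card_eq_zero.1 h'
      exact eq_zero_of_sum_eq_zero hxf (by simpa using hs)
    · obtain ⟨u, rfl⟩ := Multiset.card_eq_one.1 h
      obtain ⟨v, rfl⟩ := Multiset.card_eq_one.1 h'
      rw [Multiset.sum_singleton, Multiset.sum_singleton] at hs
      rw [hs]

theorem catenaryDegree_eq_zero_of_le_one (h : catenaryDegree a ≤ 1) : catenaryDegree a = 0 := by
  rw [← nonpos_iff_eq_zero, catenaryDegree_le_iff]
  intro z hz z' hz'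
  have hc := catenaryDegree_le_iff.1 h z hz z' hz'
  suffices z = z' by
    subst this
    exact Relation.ReflTransGen.refl
  clear hz'
  induction hc with
  | refl => rfl
  | tail _ hxy ih => exact ih.trans (eq_of_dist_le_one hxy.1 hxy.2.1 (by exact_mod_cast hxy.2.2))

/-- If `x` were skipped, induction on the number of terms would bound all catenary degrees by `x`:
shorter sequences have degree at most `x - 1`, and `isChainConnected_succ` adds one. Its requirement
`2 ≤ M` becomes `3 ≤ x`. -/
theorem exists_catenaryDegree_eq_of_le {x y : ℕ} (hx : 3 ≤ x) (hxy : x ≤ y)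
    (hy : ∃ a : zeroSumMonoid G, catenaryDegree a = y) :
    ∃ a : zeroSumMonoid G, catenaryDegree a = x := by
  by_contra! hne
  have key : ∀ a : zeroSumMonoid G, catenaryDegree a ≤ x := by
    intro a
    induction hn : len a using Nat.strong_induction_on generalizing a with
    | _ n ih =>
      obtain ⟨m, rfl⟩ : ∃ m, x = m + 1 := ⟨x - 1, by omega⟩
      refine catenaryDegree_le_iff.2 (isChainConnected_succ (by omega) fun b hb => ?_)
      have h1 := lt_of_le_of_ne (ih (len b) (hn ▸ hb) b rfl) (hne b)
      rw [← catenaryDegree_le_iff]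
      exact Order.le_of_lt_add_one (by exact_mod_cast h1)
  obtain ⟨a, ha⟩ := hy
  have := key a
  rw [ha] at this
  have : y ≤ x := by exact_mod_cast this
  exact hne a (by rw [ha, le_antisymm this hxy])

theorem catenaryDegree_le_card_mul_card [Finite G] (a : zeroSumMonoid G) :
    catenaryDegree a ≤ ((Nat.card G * Nat.card G : ℕ) : ℕ∞) :=
  catenaryDegree_le_iff.2 (isChainConnected_card_mul_card a)

theorem isFiniteInterval_setOfDistances [Finite G] :
    IsFiniteInterval (setOfDistances (zeroSumMonoid G)) := by
  refine isFiniteInterval_of_ordConnected ⟨Nat.card G * Nat.card G, fun d hd => ?_⟩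
    ⟨fun x hx y hy e he => ?_⟩
  · obtain ⟨hd, a, k, ⟨z, hz, hzk⟩, ⟨z', hz', hzk'⟩, hgap⟩ := mem_setOfDistances.1 hd
    exact (isChainConnected_card_mul_card a z hz z' hz').gap_le hgap hzk.le (by omega)
  · exact mem_setOfDistances_of_le ((mem_setOfDistances.1 hx).1.trans_le he.1) he.2 hy

theorem exists_isFiniteInterval_setOfCatenaryDegrees_eq [Finite G] :
    ∃ I : Set ℕ, IsFiniteInterval I ∧
      setOfCatenaryDegrees (zeroSumMonoid G) = (fun n : ℕ => (n : ℕ∞)) '' I := by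
  refine ⟨{n | (n : ℕ∞) ∈ setOfCatenaryDegrees (zeroSumMonoid G)},
    isFiniteInterval_of_ordConnected ⟨Nat.card G * Nat.card G, ?_⟩ ⟨?_⟩, ?_⟩
  · rintro n ⟨-, a, ha⟩
    have := catenaryDegree_le_card_mul_card a
    rw [ha] at this
    exact_mod_cast this
  · rintro x ⟨hx0, a, ha⟩ y ⟨hy0, hy⟩ n ⟨hxn, hny⟩
    rcases hxn.eq_or_lt with rfl | hlt
    · exact ⟨hx0, a, ha⟩
    -- The degree `1` does not occur, so `x ≥ 2` and every `n` above `x` is at least `3`.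
    have hx1 : 1 < x := by
      by_contra! h
      have := catenaryDegree_eq_zero_of_le_one (a := a) (by rw [ha]; exact_mod_cast h)
      exact hx0.ne' (ha ▸ this)
    exact ⟨by exact_mod_cast (by omega : 0 < n),
      exists_catenaryDegree_eq_of_le (by omega) hny hy⟩
  · ext c
    constructor
    · rintro ⟨hc, a, rfl⟩
      have hne : catenaryDegree a ≠ ⊤ := ne_top_of_le_ne_top (ENat.natCast_ne_top _)
        (catenaryDegree_le_card_mul_card a)
      exact ⟨(catenaryDegree a).toNat, by
        rw [Set.mem_ofPred_eq, ENat.natCast_toNat hne]; exact ⟨hc, a, rfl⟩, ENat.natCast_toNat hne⟩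
    · rintro ⟨n, hn, rfl⟩
      exact hn

end Catenary
end ZeroSum

theorem theorem6p1 (G : Type*) [AddCommGroup G] [Finite G] :
    ((∀ L ∈ ZeroSum.systemOfLengths (ZeroSum.zeroSumMonoid G), L.ncard = 1) ↔ Nat.card G ≤ 2) ∧
    (∀ k : ℕ, 1 ≤ k →
      ZeroSum.IsFiniteInterval (ZeroSum.unionOfLengths (ZeroSum.zeroSumMonoid G) k)) ∧
    ZeroSum.IsFiniteInterval (ZeroSum.setOfDistances (ZeroSum.zeroSumMonoid G)) ∧
    (∃ I : Set ℕ, ZeroSum.IsFiniteInterval I ∧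
      ZeroSum.setOfCatenaryDegrees (ZeroSum.zeroSumMonoid G) = (fun n : ℕ => (n : ℕ∞)) '' I) := by
  exact ⟨ZeroSum.ncard_lengths_eq_one_iff, fun k _ => ZeroSum.isFiniteInterval_unionOfLengths k,
    ZeroSum.isFiniteInterval_setOfDistances,
    ZeroSum.exists_isFiniteInterval_setOfCatenaryDegrees_eq⟩
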